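/- Private information delivery with $K\ge 2$ messages, $N$ servers and $M=2$ messages stored per server. Fix a finite field $\mathbb F$. A scheme consists of the following. Each message $W_1,\dots,W_K$ is a vector of $L\ge 1$ i.i.d. uniform symbols of $\mathbb F$, and the messages are independent. Server $n\in\{1,\dots,N\}$ stores the messages $W_j$, $j\in\mathcal S_n$, for a chosen set $\mathcal S_n\subseteq\{1,\dots,K\}$ with $|\mathcal S_n|=2$. The servers share a random variable $Z$ independent of $(W_1,\dots,W_K)$, of arbitrary size. To deliver message $k$, server $n$ sends to the user an answer $A_n^{[k]}\in\mathbb F^{D_n}$, which is a function of $(W_j)_{j\in\mathcal S_n}$ and $Z$; the length $D_n$ does not depend on $k$. For every $k$ the message $W_k$ has to be a function of $(A_1^{[k]},\dots,A_N^{[k]})$ (zero-error decoding), and the joint distribution of $(A_1^{[k]},\dots,A_N^{[k]},W_k)$ must be the same for all $k$ (privacy). The rate of the scheme is $L/\sum_{n=1}^N D_n$, a rate $R$ is achievable if some scheme has rate at least $R$, and the capacity $C$ is the supremum of the achievable rates over all storage designs $(\mathcal S_n)$ and all schemes ($C=0$ if there is no scheme). Then, for every finite field $\mathbb F$, $$C=\begin{cases}2/K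 & \text{if } N\ge\lceil K/2\rceil+1,\\[2pt] 1/\lceil K/2\rceil & \text{if } N=\lceil K/2\rceil,\\[2pt] 0 & \text{if } N<\lceil K/2\rceil.\end{cases}$$ -/

import Mathlib

open MeasureTheory ProbabilityTheory
open scoped ENNReal

universe u

/-- A private information delivery (PID) scheme with `K` messages, `N` servers and `M` of the
messages replicated at each server, all symbols being taken from the finite field `F`
(whose σ-algebra is the discrete one). All random variables live on one probability space `Ω`. -/
structure PIDScheme (F : Type u) [Field F] [Fintype F] [MeasurableSpace F]
    [MeasurableSingletonClass F] (K N M : ℕ) where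
  /-- number of symbols of each message -/
  L : ℕ
  L_pos : 0 < L
  /-- `S n` is the set of indices of the messages stored at server `n` -/
  S : Fin N → Finset (Fin K)
  card_S : ∀ n, (S n).card = M
  /-- `D n` is the number of symbols sent by server `n` to the user -/
  D : Fin N → ℕ
  Ω : Type u
  [measurableSpaceΩ : MeasurableSpace Ω]
  P : Measure Ω
  [isProbabilityMeasure : IsProbabilityMeasure P]
  /-- the messages, each a vector of `L` symbols -/
  W : Fin K → Ω → (Fin L → F)
  measurable_W : ∀ k, Measurable (W k)
  /-- every symbol of every message is uniform -/
  uniform_W : ∀ k i a, P {ω | W k ω i = a} = (Fintype.card F : ℝ≥0∞)⁻¹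
  /-- the symbols of each message are independent -/
  indep_symbols : ∀ k, iIndepFun (fun i ω => W k ω i) P
  /-- the messages are independent -/
  indep_messages : iIndepFun W P
  /-- the alphabet of the common randomness -/
  𝒵 : Type u
  [measurableSpaceZ : MeasurableSpace 𝒵]
  /-- the common randomness shared by the servers -/
  Z : Ω → 𝒵
  measurable_Z : Measurable Z
  /-- the common randomness is independent of the collection of all messages -/
  indep_Z : IndepFun (fun ω k => W k ω) Z P
  /-- `A k n` is the answer of server `n` when message `k` is to be delivered -/
  A : Fin K → (n : Fin N) → Ω → (Fin (D n) → F)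
  measurable_A : ∀ k n, Measurable (A k n)
  /-- the answer of server `n` is (almost surely) a function of the messages stored at server `n`
  and of the common randomness -/
  answer : ∀ k n, ∃ f : (S n → Fin L → F) × 𝒵 → (Fin (D n) → F), Measurable f ∧
    A k n =ᵐ[P] fun ω => f (fun j => W j ω, Z ω)
  /-- zero-error decoding: the desired message is (almost surely) a function of all answers -/
  decode : ∀ k, ∃ g : ((n : Fin N) → Fin (D n) → F) → (Fin L → F),
    W k =ᵐ[P] fun ω => g (fun n => A k n ω)
  /-- privacy: the joint law of the answers and the desired message does not depend on which
  message is delivered -/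
  privacy : ∀ k k', IdentDistrib (fun ω => ((fun n => A k n ω), W k ω))
    (fun ω => ((fun n => A k' n ω), W k' ω)) P P

namespace PIDScheme

variable {F : Type u} [Field F] [Fintype F] [MeasurableSpace F] [MeasurableSingletonClass F]
  {K N M : ℕ}

/-- The rate of a scheme: message symbols delivered per symbol of total download. -/
noncomputable def rate (s : PIDScheme F K N M) : ℝ≥0∞ :=
  (s.L : ℝ≥0∞) / ((∑ n, s.D n : ℕ) : ℝ≥0∞)

end PIDScheme

/-- The rate `R` is achievable if some scheme has rate at least `R`. -/
def PIDAchievable (F : Type u) [Field F] [Fintype F] [MeasurableSpace F]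
    [MeasurableSingletonClass F] (K N M : ℕ) (R : ℝ≥0∞) : Prop :=
  ∃ s : PIDScheme F K N M, R ≤ s.rate

/-- The capacity: the supremum of the achievable rates over all storage designs and all schemes.
It is taken in `[0, ∞]`, so it is `0` when there is no scheme at all. -/
noncomputable def pidCapacity (F : Type u) [Field F] [Fintype F] [MeasurableSpace F]
    [MeasurableSingletonClass F] (K N M : ℕ) : ℝ≥0∞ :=
  sSup {R | PIDAchievable F K N M R}

/-! Converse: freeze the common randomness at a value for which decoding never fails. With the other
messages fixed, only the servers storing message k react to it, so together they send at least L
symbols (`length_le_sum_storing`). Summing over k counts each server twice and gives K L ≤ 2 ∑ D n.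
If 2N = K + 1, each server holds a message found nowhere else, hence sends L symbols by itself.

Achievability: fix an additive decoder g that is onto already on the answers of the servers storing
k, for every k. Send a shared uniform mask, corrected on those servers so that g returns the
message. The joint law of answers and message does not depend on k, because a bijection of the
uniform sample space exchanges k and k' (`maskedScheme`). It remains to choose g: the sum of all
symbols, or, for odd K with a spare server, a triangle of three servers. -/

namespace PIDScheme

/-! ### Converse: bounds on the download and on the storage. -/

section Converse

variable {F : Type u} [Field F] [Fintype F] [MeasurableSpace F] [MeasurableSingletonClass F]
  {K N M : ℕ}

/-- Every value of the collection of all messages has positive probability. -/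
theorem measure_messages_eq_ne_zero (s : PIDScheme F K N M) (w : Fin K → Fin s.L → F) :
    letI := s.measurableSpaceΩ
    s.P ((fun ω k => s.W k ω) ⁻¹' {w}) ≠ 0 := by
  let := s.measurableSpaceΩ
  have h1 : (fun ω k => s.W k ω) ⁻¹' {w} = ⋂ k ∈ Finset.univ, s.W k ⁻¹' {w k} := by
    ext ω; simp [funext_iff]
  rw [h1, s.indep_messages.measure_inter_preimage_eq_mul Finset.univ
    (fun k _ => measurableSet_singleton (w k))]
  refine Finset.prod_ne_zero_iff.2 fun k _ => ?_
  have h2 : s.W k ⁻¹' {w k} = ⋂ i ∈ Finset.univ, (fun ω => s.W k ω i) ⁻¹' {w k i} := by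
    ext ω; simp [funext_iff]
  rw [h2, (s.indep_symbols k).measure_inter_preimage_eq_mul Finset.univ
    (fun i _ => measurableSet_singleton (w k i))]
  refine Finset.prod_ne_zero_iff.2 fun i _ => ?_
  have h3 : (fun ω => s.W k ω i) ⁻¹' {w k i} = {ω | s.W k ω i = w k i} := rfl
  rw [h3, s.uniform_W]
  exact ENNReal.inv_ne_zero.2 (ENNReal.natCast_ne_top _)

/-- For a suitable value of the common randomness, decoding succeeds for all message values. -/
theorem exists_deterministic_decoding (s : PIDScheme F K N M) (k : Fin K) :
    ∃ (f : ∀ n, (s.S n → Fin s.L → F) → (Fin (s.D n) → F))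
      (g : ((n : Fin N) → Fin (s.D n) → F) → (Fin s.L → F)),
      ∀ w : Fin K → Fin s.L → F, w k = g fun n => f n fun j => w j := by
  let := s.measurableSpaceΩ
  let := s.measurableSpaceZ
  have := s.isProbabilityMeasure
  choose f hf hA using s.answer k
  obtain ⟨g, hg⟩ := s.decode k
  have key : ∀ w : Fin K → Fin s.L → F,
      ∀ᵐ ω ∂s.P, w k = g fun n => f n (fun j => w j, s.Z ω) := by
    intro w
    have hm : Measurable fun z : s.𝒵 => g fun n => f n (fun j : s.S n => w j, z) :=
      (Measurable.of_discrete (f := g)).comp (measurable_pi_lambda _ fun n =>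
        (hf n).comp (measurable_const.prodMk measurable_id))
    have hC : MeasurableSet {z : s.𝒵 | w k = g fun n => f n (fun j : s.S n => w j, z)}ᶜ :=
      (measurableSet_eq_fun measurable_const hm).compl
    -- The null event "messages equal w and Z is bad for w" factors by independence; since w has
    -- positive probability, Z is almost surely good for w.
    have hmul := s.indep_Z.measure_inter_preimage_eq_mul _ _ (measurableSet_singleton w) hC
    have hnull : s.P ((fun ω k => s.W k ω) ⁻¹' {w} ∩
        s.Z ⁻¹' {z : s.𝒵 | w k = g fun n => f n (fun j : s.S n => w j, z)}ᶜ) = 0 := by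
      have hae : ∀ᵐ ω ∂s.P, s.W k ω = g fun n => f n (fun j => s.W j ω, s.Z ω) := by
        filter_upwards [hg, ae_all_iff.2 hA] with ω h1 h2
        rw [h1]
        exact congrArg g (funext h2)
      refine measure_mono_null ?_ (ae_iff.1 hae)
      rintro ω ⟨h1, h2⟩ h3
      refine h2 ?_
      have h4 : (fun k => s.W k ω) = w := h1
      subst h4
      exact h3
    rw [hnull] at hmul
    exact ae_iff.2 ((mul_eq_zero.1 hmul.symm).resolve_left (s.measure_messages_eq_ne_zero w))
  -- There are finitely many w, so one value of Z is good for all of them.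
  obtain ⟨ω, hω⟩ := (ae_all_iff.2 key).exists
  exact ⟨fun n x => f n (x, s.Z ω), g, hω⟩

/-- The servers storing message `k` have to send at least `L` symbols altogether. -/
theorem length_le_sum_storing (s : PIDScheme F K N M) (k : Fin K) :
    s.L ≤ ∑ n with k ∈ s.S n, s.D n := by
  classical
  obtain ⟨f, g, h⟩ := s.exists_deterministic_decoding k
  let T : Finset (Fin N) := Finset.univ.filter fun n => k ∈ s.S n
  let w : (Fin s.L → F) → Fin K → Fin s.L → F := fun x => Function.update 0 k x
  let φ : (Fin s.L → F) → ((n : T) → Fin (s.D n) → F) := fun x n => f n fun j => w x j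
  have hφ : Function.Injective φ := by
    intro x y hxy
    have hans : (fun n => f n fun j => w x j) = fun n => f n fun j => w y j := by
      funext n
      by_cases hn : k ∈ s.S n
      · exact congrFun hxy ⟨n, by simp [T, hn]⟩
      · congr 1
        funext j
        have hj : (j : Fin K) ≠ k := fun e => hn (e ▸ j.2)
        simp [w, hj]
    have hx := h (w x)
    have hy := h (w y)
    rw [hans, ← hy] at hx
    simpa [w] using hx
  have hcard := Fintype.card_le_of_injective φ hφ
  simp only [Fintype.card_pi, Finset.prod_const, Finset.card_univ, Fintype.card_fin,
    Finset.prod_pow_eq_pow_sum] at hcard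
  have hle := (Nat.pow_le_pow_iff_right (Fintype.one_lt_card (α := F))).1 hcard
  rwa [Finset.sum_coe_sort T s.D] at hle

theorem sum_sum_storing (s : PIDScheme F K N M) (x : Fin N → ℕ) :
    ∑ k, ∑ n with k ∈ s.S n, x n = M * ∑ n, x n := by
  simp_rw [Finset.sum_filter]
  rw [Finset.sum_comm, Finset.mul_sum]
  refine Finset.sum_congr rfl fun n _ => ?_
  rw [← Finset.sum_filter, Finset.filter_mem_eq_inter, Finset.univ_inter, Finset.sum_const,
    s.card_S, smul_eq_mul]

theorem messages_mul_length_le (s : PIDScheme F K N M) : K * s.L ≤ M * ∑ n, s.D n := by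
  rw [← s.sum_sum_storing]
  simpa using Finset.sum_le_sum fun k (_ : k ∈ Finset.univ) => s.length_le_sum_storing k

theorem exists_mem_storage (s : PIDScheme F K N M) (k : Fin K) : ∃ n, k ∈ s.S n := by
  by_contra! hk
  have h := s.length_le_sum_storing k
  simp only [hk, Finset.filter_false, Finset.sum_empty] at h
  exact absurd s.L_pos (by omega)

theorem one_le_card_storing (s : PIDScheme F K N M) (k : Fin K) :
    1 ≤ ∑ n with k ∈ s.S n, 1 := by
  obtain ⟨n, hn⟩ := s.exists_mem_storage k
  rw [← Finset.card_eq_sum_ones, Nat.one_le_iff_ne_zero, ← Nat.pos_iff_ne_zero,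
    Finset.card_pos]
  exact ⟨n, by simp [hn]⟩

theorem messages_le_storage (s : PIDScheme F K N M) : K ≤ M * N := by
  have h := s.sum_sum_storing fun _ => 1
  have h' := Finset.sum_le_sum fun k (_ : k ∈ Finset.univ) => s.one_le_card_storing k
  rw [h] at h'
  simpa using h'

/-- If the storage has a single redundant slot, every server stores a message that no other server
stores. -/
theorem exists_message_stored_once (s : PIDScheme F K N 2) (hKN : K + 1 = 2 * N) (n : Fin N) :
    ∃ k, (Finset.univ.filter fun n' => k ∈ s.S n') = {n} := by
  by_contra! hn
  have htwo : ∀ k ∈ s.S n, 2 ≤ ∑ n' with k ∈ s.S n', 1 := by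
    intro k hk
    rw [← Finset.card_eq_sum_ones]
    by_contra! hlt
    refine hn k (Finset.eq_singleton_iff_unique_mem.2 ⟨by simp [hk], fun y hy => ?_⟩)
    exact Finset.card_le_one.1 (by omega) y hy n (by simp [hk])
  -- If both messages of server n were stored elsewhere too, at least K + 2 slots would be used, but
  -- only 2N = K + 1 exist.
  have hle : ∑ k : Fin K, (1 + if k ∈ s.S n then 1 else 0) ≤
      ∑ k : Fin K, ∑ n' with k ∈ s.S n', 1 := by
    refine Finset.sum_le_sum fun k _ => ?_
    split_ifs with hk
    · exact htwo k hk
    · exact s.one_le_card_storing k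
  rw [s.sum_sum_storing, Finset.sum_add_distrib, ← Finset.sum_filter, Finset.filter_mem_eq_inter,
    Finset.univ_inter, ← Finset.card_eq_sum_ones, ← Finset.card_eq_sum_ones, s.card_S] at hle
  simp only [Finset.card_univ, Fintype.card_fin, Finset.sum_const, smul_eq_mul, mul_one] at hle
  omega

theorem servers_mul_length_le (s : PIDScheme F K N 2) (hKN : K + 1 = 2 * N) :
    N * s.L ≤ ∑ n, s.D n := by
  have h : ∀ n ∈ (Finset.univ : Finset (Fin N)), s.L ≤ s.D n := by
    intro n _
    obtain ⟨k, hk⟩ := s.exists_message_stored_once hKN n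
    have h := s.length_le_sum_storing k
    rwa [hk, Finset.sum_singleton] at h
  simpa using Finset.sum_le_sum h

theorem rate_le_div (s : PIDScheme F K N M) {a b : ℕ} (ha : 0 < a)
    (h : a * s.L ≤ b * ∑ n, s.D n) : s.rate ≤ (b : ℝ≥0∞) / (a : ℝ≥0∞) := by
  have hL := s.L_pos
  -- A zero download would make the rate ∞ in `ℝ≥0∞`.
  have hD : ∑ n, s.D n ≠ 0 := by
    intro h0
    rw [h0, mul_zero] at h
    have := Nat.mul_pos ha hL
    omega
  unfold rate
  have ha' : (a : ℝ≥0∞) ≠ 0 := by exact_mod_cast ha.ne'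
  have hD' : ((∑ n, s.D n : ℕ) : ℝ≥0∞) ≠ 0 := by exact_mod_cast hD
  rw [ENNReal.div_le_iff hD' (ENNReal.natCast_ne_top _), mul_comm, ← mul_div_assoc,
    ENNReal.le_div_iff_mul_le (Or.inl ha') (Or.inl (ENNReal.natCast_ne_top _))]
  have h' : s.L * a ≤ (∑ n, s.D n) * b := by linarith
  exact_mod_cast h'

end Converse

end PIDScheme

/-! ### Masked answers and the exchange of two messages. -/

section MaskedAnswers

variable {F : Type u} [Field F] {K N : ℕ}
  {L : ℕ} {D : Fin N → ℕ} {g : ((n : Fin N) → Fin (D n) → F) →+ (Fin L → F)}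
  {t : Fin K → (Fin L → F) → ((n : Fin N) → Fin (D n) → F)}

/-- The answers that deliver the message `w`: the mask `z`, corrected by a preimage under the
decoder `g` of the decoding error. -/
def maskedAnswer {L : ℕ} {D : Fin N → ℕ}
    (g : ((n : Fin N) → Fin (D n) → F) →+ (Fin L → F))
    (t : (Fin L → F) → ((n : Fin N) → Fin (D n) → F)) (w : Fin L → F)
    (z : (n : Fin N) → Fin (D n) → F) : (n : Fin N) → Fin (D n) → F :=
  z + t (w - g z)

/-- Exchange the roles of the messages `k` and `k'`, keeping the answers unchanged. -/
def exchangeMessages {L : ℕ} {D : Fin N → ℕ}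
    (g : ((n : Fin N) → Fin (D n) → F) →+ (Fin L → F))
    (t : Fin K → (Fin L → F) → ((n : Fin N) → Fin (D n) → F)) (k k' : Fin K)
    (ω : (Fin K → Fin L → F) × ((n : Fin N) → Fin (D n) → F)) :
    (Fin K → Fin L → F) × ((n : Fin N) → Fin (D n) → F) :=
  (ω.1 ∘ Equiv.swap k k', maskedAnswer g (t k) (ω.1 k) ω.2 - t k' (ω.1 k - g ω.2))

theorem apply_maskedAnswer {t : (Fin L → F) → ((n : Fin N) → Fin (D n) → F)}
    (ht : ∀ w, g (t w) = w) (w : Fin L → F) (z : (n : Fin N) → Fin (D n) → F) :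
    g (maskedAnswer g t w z) = w := by
  simp [maskedAnswer, ht]

/-- The corrections `t k` and `t k'` of the same error have the same image under g, so trading one
for the other keeps the error. This makes the exchange invertible. -/
theorem sub_apply_exchangeMessages (ht : ∀ k w, g (t k w) = w) (k k' : Fin K)
    (ω : (Fin K → Fin L → F) × ((n : Fin N) → Fin (D n) → F)) :
    ω.1 k - g (exchangeMessages g t k k' ω).2 = ω.1 k - g ω.2 := by
  simp only [exchangeMessages, map_sub, apply_maskedAnswer (ht k), ht]
  abel

theorem maskedAnswer_exchangeMessages (ht : ∀ k w, g (t k w) = w) (k k' : Fin K)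
    (ω : (Fin K → Fin L → F) × ((n : Fin N) → Fin (D n) → F)) :
    maskedAnswer g (t k') ((exchangeMessages g t k k' ω).1 k') (exchangeMessages g t k k' ω).2 =
      maskedAnswer g (t k) (ω.1 k) ω.2 := by
  have h1 : (exchangeMessages g t k k' ω).1 k' = ω.1 k := by simp [exchangeMessages]
  rw [maskedAnswer, h1, sub_apply_exchangeMessages ht, exchangeMessages, sub_add_cancel]

theorem exchangeMessages_exchangeMessages (ht : ∀ k w, g (t k w) = w) (k k' : Fin K)
    (ω : (Fin K → Fin L → F) × ((n : Fin N) → Fin (D n) → F)) :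
    exchangeMessages g t k' k (exchangeMessages g t k k' ω) = ω := by
  have h1 : (exchangeMessages g t k k' ω).1 k' = ω.1 k := by simp [exchangeMessages]
  refine Prod.ext ?_ ?_
  · funext j
    simp [exchangeMessages, Equiv.swap_comm k' k]
  · rw [exchangeMessages, maskedAnswer_exchangeMessages ht, h1, sub_apply_exchangeMessages ht]
    simp [maskedAnswer]

end MaskedAnswers

/-- A measure giving the same mass to all points of a countable space is preserved by every
permutation. -/
theorem map_equiv_eq_of_measure_singleton_eq {α : Type*} [MeasurableSpace α] [Countable α]
    [DiscreteMeasurableSpace α] {μ : Measure α} (h : ∀ x y, μ {x} = μ {y}) (e : α ≃ α) :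
    μ.map e = μ := by
  refine Measure.ext_of_singleton fun x => ?_
  have hx : e ⁻¹' {x} = {e.symm x} := by
    ext y
    simp [Equiv.eq_symm_apply]
  rw [Measure.map_apply Measurable.of_discrete (measurableSet_singleton x), hx]
  exact h _ _

theorem iIndepFun_comp_measurePreserving {ι α β γ : Type*} [Fintype ι] [MeasurableSpace α]
    [MeasurableSpace β] [MeasurableSpace γ] {μ : Measure α} {ν : Measure β}
    [IsProbabilityMeasure μ] [IsProbabilityMeasure ν] {f : α → β} (hf : MeasurePreserving f μ ν)
    {X : ι → β → γ} (hX : ∀ i, Measurable (X i)) (h : iIndepFun X ν) :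
    iIndepFun (fun i a => X i (f a)) μ := by
  rw [iIndepFun_iff_map_fun_eq_pi_map fun i => (hX i).aemeasurable] at h
  refine (iIndepFun_iff_map_fun_eq_pi_map
    fun i => ((hX i).comp hf.measurable).aemeasurable).2 ?_
  rw [← hf.map_eq, Measure.map_map (measurable_pi_lambda _ hX) hf.measurable] at h
  refine h.trans (congrArg Measure.pi (funext fun i => ?_))
  rw [Measure.map_map (hX i) hf.measurable]

/-! ### The uniform law, and privacy of the masked scheme. -/

section UniformLaw

variable {F : Type u} [Field F] [Fintype F] [MeasurableSpace F] {K N : ℕ}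

/-- The uniform probability measure on a finite field. -/
noncomputable def uniformSymbol (F : Type u) [Field F] [Fintype F] [MeasurableSpace F] :
    Measure F :=
  (PMF.uniformOfFintype F).toMeasure

instance : IsProbabilityMeasure (uniformSymbol F) := by
  unfold uniformSymbol; infer_instance

/-- The joint law of independent uniform messages and independent uniform answer masks. -/
noncomputable def uniformMessagesMasks (F : Type u) [Field F] [Fintype F] [MeasurableSpace F]
    (K : ℕ) {N : ℕ} (L : ℕ) (D : Fin N → ℕ) :
    Measure ((Fin K → Fin L → F) × ((n : Fin N) → Fin (D n) → F)) :=
  (Measure.pi fun _ => Measure.pi fun _ => uniformSymbol F).prod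
    (Measure.pi fun _ => Measure.pi fun _ => uniformSymbol F)

instance (L : ℕ) (D : Fin N → ℕ) : IsProbabilityMeasure (uniformMessagesMasks F K L D) := by
  unfold uniformMessagesMasks; infer_instance

theorem measurePreserving_message (F : Type u) [Field F] [Fintype F] [MeasurableSpace F]
    {K N : ℕ} (L : ℕ) (D : Fin N → ℕ) (k : Fin K) :
    MeasurePreserving (fun ω => ω.1 k) (uniformMessagesMasks F K L D)
      (Measure.pi fun _ => uniformSymbol F) :=
  (measurePreserving_eval (fun _ : Fin K => Measure.pi fun _ : Fin L => uniformSymbol F) k).comp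
    measurePreserving_fst

end UniformLaw

section Achievability

variable {F : Type u} [Field F] [Fintype F] [MeasurableSpace F] [MeasurableSingletonClass F]
  {K N M : ℕ}

theorem uniformSymbol_singleton (a : F) : uniformSymbol F {a} = (Fintype.card F : ℝ≥0∞)⁻¹ := by
  rw [uniformSymbol, PMF.toMeasure_apply_singleton _ _ (measurableSet_singleton a),
    PMF.uniformOfFintype_apply]

theorem uniformMessagesMasks_singleton (L : ℕ) (D : Fin N → ℕ)
    (x y : (Fin K → Fin L → F) × ((n : Fin N) → Fin (D n) → F)) :
    uniformMessagesMasks F K L D {x} = uniformMessagesMasks F K L D {y} := by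
  obtain ⟨x₁, x₂⟩ := x
  obtain ⟨y₁, y₂⟩ := y
  simp only [uniformMessagesMasks, ← Set.singleton_prod_singleton, Measure.prod_prod,
    Measure.pi_singleton, uniformSymbol_singleton]

section

variable {L : ℕ} {D : Fin N → ℕ} {g : ((n : Fin N) → Fin (D n) → F) →+ (Fin L → F)}
  {t : Fin K → (Fin L → F) → ((n : Fin N) → Fin (D n) → F)}

theorem map_exchangeMessages (ht : ∀ k w, g (t k w) = w) (k k' : Fin K) :
    (uniformMessagesMasks F K L D).map (exchangeMessages g t k k') =
      uniformMessagesMasks F K L D :=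
  map_equiv_eq_of_measure_singleton_eq (uniformMessagesMasks_singleton L D)
    ⟨exchangeMessages g t k k', exchangeMessages g t k' k,
      exchangeMessages_exchangeMessages ht k k', exchangeMessages_exchangeMessages ht k' k⟩

/-- A decoder `g` such that every value can be produced by altering only the answers of the servers
that store message `k`, for each `k`, gives a scheme. -/
noncomputable def maskedScheme (hL : 0 < L) (S : Fin N → Finset (Fin K))
    (hS : ∀ n, (S n).card = M) (ht : ∀ k w, g (t k w) = w)
    (hsupp : ∀ k w n, k ∉ S n → t k w n = 0) : PIDScheme F K N M where
  L := L
  L_pos := hL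
  S := S
  card_S := hS
  D := D
  Ω := (Fin K → Fin L → F) × ((n : Fin N) → Fin (D n) → F)
  P := uniformMessagesMasks F K L D
  W k ω := ω.1 k
  measurable_W _ := Measurable.of_discrete
  uniform_W k i a := by
    have h := (measurePreserving_eval (fun _ : Fin L => uniformSymbol F) i).comp
      (measurePreserving_message F L D k)
    rw [← uniformSymbol_singleton a,
      ← h.measure_preimage (measurableSet_singleton a).nullMeasurableSet]
    rfl
  indep_symbols k :=
    iIndepFun_comp_measurePreserving (measurePreserving_message F L D k)
      (fun i => measurable_pi_apply i)
      (iIndepFun_pi (μ := fun _ : Fin L => uniformSymbol F) (X := fun _ x => x)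
        fun _ => aemeasurable_id)
  indep_messages :=
    iIndepFun_comp_measurePreserving measurePreserving_fst (fun k => measurable_pi_apply k)
      (iIndepFun_pi (μ := fun _ : Fin K => Measure.pi fun _ : Fin L => uniformSymbol F)
        (X := fun _ x => x) fun _ => aemeasurable_id)
  𝒵 := (n : Fin N) → Fin (D n) → F
  Z ω := ω.2
  measurable_Z := measurable_snd
  indep_Z := indepFun_prod (X := fun x => x) (Y := fun x => x) measurable_id measurable_id
  A k n ω := maskedAnswer g (t k) (ω.1 k) ω.2 n
  measurable_A _ _ := Measurable.of_discrete
  answer k n := by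
    classical
    refine ⟨fun x => if h : k ∈ S n then maskedAnswer g (t k) (x.1 ⟨k, h⟩) x.2 n else x.2 n,
      Measurable.of_discrete, Filter.Eventually.of_forall fun ω => ?_⟩
    by_cases h : k ∈ S n
    · simp [h]
    · simp [h, maskedAnswer, hsupp k _ n h]
  decode k := ⟨g, Filter.Eventually.of_forall fun ω => (apply_maskedAnswer (ht k) _ _).symm⟩
  privacy k k' := by
    refine ⟨Measurable.of_discrete.aemeasurable, Measurable.of_discrete.aemeasurable, ?_⟩
    -- After the exchange, delivering k' yields pointwise the same answers and message as delivering
    -- k before it.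
    conv_rhs => rw [← map_exchangeMessages ht k k']
    rw [Measure.map_map Measurable.of_discrete Measurable.of_discrete]
    congr 1
    funext ω
    refine Prod.ext ?_ ?_
    · exact (maskedAnswer_exchangeMessages ht k k' ω).symm
    · simp [exchangeMessages]

end

theorem pidAchievable_of_decoder {L : ℕ} (hL : 0 < L) (S : Fin N → Finset (Fin K))
    (hS : ∀ n, (S n).card = M) (D : Fin N → ℕ)
    (g : ((n : Fin N) → Fin (D n) → F) →+ (Fin L → F))
    (h : ∀ k w, ∃ v, g v = w ∧ ∀ n, k ∉ S n → v n = 0) :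
    PIDAchievable F K N M ((L : ℝ≥0∞) / ((∑ n, D n : ℕ) : ℝ≥0∞)) := by
  choose t ht hsupp using h
  exact ⟨maskedScheme hL S hS ht hsupp, le_rfl⟩

/-! ### Explicit storage designs and linear decoders. -/

/-- The pair of messages with indices `a` and `b`. -/
def messagePair (K a b : ℕ) : Finset (Fin K) :=
  Finset.univ.filter fun k => k.val = a ∨ k.val = b

theorem card_messagePair {a b : ℕ} (hab : a < b) (hb : b < K) :
    (messagePair K a b).card = 2 := by
  have h : messagePair K a b = {⟨a, hab.trans hb⟩, ⟨b, hb⟩} := by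
    ext k
    simp [messagePair, Fin.ext_iff]
  rw [h, Finset.card_pair]
  simp [Fin.ext_iff, hab.ne]

theorem mem_messagePair {a b : ℕ} {k : Fin K} :
    k ∈ messagePair K a b ↔ k.val = a ∨ k.val = b := by
  simp [messagePair]

/-- The linear decoder that weights symbol `i` of server `n` by the vector `c n i`. -/
def linearDecoder {R : Type*} [Field R] {L : ℕ} (c : ℕ → ℕ → Fin L → R) (D : ℕ → ℕ) (N : ℕ) :
    ((n : Fin N) → Fin (D n) → R) →+ (Fin L → R) :=
  AddMonoidHom.mk' (fun v => ∑ n : Fin N, ∑ i : Fin (D n), v n i • c n i) fun v v' => by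
    simp only [Pi.add_apply, add_smul, Finset.sum_add_distrib]

theorem linearDecoder_apply {R : Type*} [Field R] {L : ℕ} (c : ℕ → ℕ → Fin L → R) (D : ℕ → ℕ)
    (N : ℕ) (f : ℕ → ℕ → R) :
    linearDecoder c D N (fun n i => f n i) =
      ∑ n ∈ Finset.range N, ∑ i ∈ Finset.range (D n), f n i • c n i := by
  rw [← Fin.sum_univ_eq_sum_range fun n => ∑ i ∈ Finset.range (D n), f n i • c n i]
  change ∑ n : Fin N, ∑ i : Fin (D n), f n i • c n i = _
  refine Finset.sum_congr rfl fun n _ => ?_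
  exact Fin.sum_univ_eq_sum_range (fun i => f n i • c n i) (D n)

/-- Additive sharing: each of `m` servers sends one symbol, their sum being the message. -/
theorem pidAchievable_additive_sharing (F : Type u) [Field F] [Fintype F] [MeasurableSpace F]
    [MeasurableSingletonClass F] {K N m : ℕ} (hK : 2 ≤ K) (hKm : K ≤ 2 * m) (hmN : m ≤ N) :
    PIDAchievable F K N 2 (1 / (m : ℝ≥0∞)) := by
  let D : ℕ → ℕ := fun n => if n < m then 1 else 0
  let S : Fin N → Finset (Fin K) := fun n =>
    -- For odd K the second case stores the unpaired last message; it also fills the spare servers.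
    if 2 * n.val + 1 < K then messagePair K (2 * n) (2 * n + 1) else messagePair K 0 (K - 1)
  have hS : ∀ n, (S n).card = 2 := by
    intro n
    dsimp only [S]
    split_ifs with h
    · exact card_messagePair (by omega) h
    · exact card_messagePair (by omega) (by omega)
  have hD : ∑ n : Fin N, D n = m := by
    rw [Fin.sum_univ_eq_sum_range D]
    obtain ⟨r, rfl⟩ := Nat.exists_eq_add_of_le hmN
    rw [Finset.sum_range_add, Finset.sum_congr rfl fun n hn => if_pos (Finset.mem_range.1 hn)]
    simp [D]
  have key := pidAchievable_of_decoder (F := F) one_pos S hS (fun n => D n)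
    (linearDecoder (fun _ _ _ => 1) D N) fun k w => by
      refine ⟨fun n _ => if n.val = k.val / 2 then w 0 else 0, ?_, fun n hn => ?_⟩
      · refine (linearDecoder_apply _ D N fun n _ => if n = k.val / 2 then w 0 else 0).trans ?_
        have hkm : k.val / 2 < m := by omega
        rw [Finset.sum_eq_single_of_mem (k.val / 2) (Finset.mem_range.2 (hkm.trans_le hmN))]
        · funext j
          simp [D, hkm, Subsingleton.elim j 0]
        · intro n _ hn
          simp [hn]
      · funext i
        refine if_neg fun h => hn ?_
        dsimp only [S]
        split_ifs <;> rw [mem_messagePair] <;> omega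
  rw [hD] at key
  simpa using key

/-- Three servers storing the pairs of three messages send one symbol each, the other servers store
disjoint pairs and send two symbols each. -/
theorem pidAchievable_triangle (F : Type u) [Field F] [Fintype F] [MeasurableSpace F]
    [MeasurableSingletonClass F] (j r : ℕ) :
    PIDAchievable F (2 * j + 3) (3 + j + r) 2 (2 / ((2 * j + 3 : ℕ) : ℝ≥0∞)) := by
  let D : ℕ → ℕ := fun n => if n < 3 then 1 else if n < 3 + j then 2 else 0
  let S : Fin (3 + j + r) → Finset (Fin (2 * j + 3)) := fun n =>
    if n.val = 0 then messagePair _ 0 1 else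
    if n.val = 1 then messagePair _ 1 2 else
    if n.val = 2 then messagePair _ 0 2 else
    if n.val < 3 + j then messagePair _ (2 * n - 3) (2 * n - 2) else messagePair _ 0 1
  -- Any two of (1,0), (0,1), (1,1) form a basis over every field, and each of the messages 0, 1, 2
  -- lies on two of the first three servers.
  let c : ℕ → ℕ → Fin 2 → F := fun n i =>
    if n = 0 then ![1, 0] else if n = 1 then ![0, 1] else if n = 2 then ![1, 1] else
    if i = 0 then ![1, 0] else ![0, 1]
  have hS : ∀ n, (S n).card = 2 := by
    intro n
    dsimp only [S]
    split_ifs <;> exact card_messagePair (by omega) (by omega)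
  have hD : ∑ n : Fin (3 + j + r), D n = 2 * j + 3 := by
    rw [Fin.sum_univ_eq_sum_range D, Finset.sum_range_add, Finset.sum_range_add,
      Finset.sum_congr (g := fun _ => 2) (s₁ := Finset.range j) rfl fun n hn => ?_]
    · rw [Finset.sum_eq_zero (s := Finset.range r) fun n _ => by
        dsimp only [D]
        rw [if_neg (by omega), if_neg (by omega)]]
      simp [D, Finset.sum_range_succ]
      omega
    · simp [D, Finset.mem_range.1 hn]
  -- Servers 0, 1, 2 miss exactly the messages 2, 0, 1 of the triangle.
  have hmem : ∀ (k : Fin (2 * j + 3)) (n : Fin (3 + j + r)), k.val < 3 → k ∉ S n → n.val < 3 →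
      k.val = (n + 2) % 3 := by
    intro k n hk hn hn3
    contrapose! hn
    dsimp only [S]
    split_ifs <;> rw [mem_messagePair] <;> omega
  have triangle : ∀ x y z : F,
      linearDecoder c D (3 + j + r) (fun n _ =>
        if n.val = 0 then x else if n.val = 1 then y else if n.val = 2 then z else 0) =
      ![x + z, y + z] := by
    intro x y z
    refine (linearDecoder_apply c D _ fun n _ =>
        if n = 0 then x else if n = 1 then y else if n = 2 then z else 0).trans ?_
    rw [add_assoc, Finset.sum_range_add, Finset.sum_eq_zero (s := Finset.range (j + r))]
    · funext i
      fin_cases i <;> simp [Finset.sum_range_succ, D, c]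
    · intro n _
      rw [if_neg (by omega), if_neg (by omega), if_neg (by omega)]
      simp
  have key := pidAchievable_of_decoder (F := F) two_pos S hS (fun n => D n)
    (linearDecoder c D _) fun k w => by
      rcases Nat.lt_or_ge k.val 3 with hk | hk
      · have hk' : k.val = 0 ∨ k.val = 1 ∨ k.val = 2 := by omega
        rcases hk' with hk' | hk' | hk'
        · refine ⟨_, (triangle (w 0 - w 1) 0 (w 1)).trans ?_, fun n hn => ?_⟩
          · funext i
            fin_cases i <;> simp
          · funext i
            have h0 : n.val ≠ 0 := fun h => by have := hmem k n hk hn; omega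
            have h2 : n.val ≠ 2 := fun h => by have := hmem k n hk hn; omega
            simp [h0, h2]
        · refine ⟨_, (triangle (w 0) (w 1) 0).trans ?_, fun n hn => ?_⟩
          · funext i
            fin_cases i <;> simp
          · funext i
            have h0 : n.val ≠ 0 := fun h => by have := hmem k n hk hn; omega
            have h1 : n.val ≠ 1 := fun h => by have := hmem k n hk hn; omega
            simp [h0, h1]
        · refine ⟨_, (triangle 0 (w 1 - w 0) (w 0)).trans ?_, fun n hn => ?_⟩
          · funext i
            fin_cases i <;> simp
          · funext i
            have h1 : n.val ≠ 1 := fun h => by have := hmem k n hk hn; omega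
            have h2 : n.val ≠ 2 := fun h => by have := hmem k n hk hn; omega
            simp [h1, h2]
      -- This is the server n with k = 2n - 3 or k = 2n - 2; its two symbols carry the whole
      -- correction.
      · refine ⟨fun n i => if n.val = (k.val + 3) / 2 then (if i.val = 0 then w 0 else w 1) else 0,
          ?_, fun n hn => ?_⟩
        · refine (linearDecoder_apply c D _ fun n i =>
            if n = (k.val + 3) / 2 then (if i = 0 then w 0 else w 1) else 0).trans ?_
          have h3 : 3 ≤ (k.val + 3) / 2 := by omega
          have hj : (k.val + 3) / 2 < 3 + j := by omega
          generalize (k.val + 3) / 2 = n₀ at h3 hj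
          rw [Finset.sum_eq_single_of_mem n₀ (Finset.mem_range.2 (by omega))]
          · have hDn : D n₀ = 2 := by simp [D, hj, h3]
            have hc : ∀ i, c n₀ i = if i = 0 then ![1, 0] else ![0, 1] := fun i => by
              dsimp only [c]
              rw [if_neg (by omega), if_neg (by omega), if_neg (by omega)]
            rw [hDn]
            simp only [hc]
            funext i
            fin_cases i <;> simp [Finset.sum_range_succ]
          · intro n _ hn
            simp [hn]
        · funext i
          refine if_neg fun h => hn ?_
          dsimp only [S]
          rw [if_neg (by omega), if_neg (by omega), if_neg (by omega), if_pos (by omega),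
            mem_messagePair]
          omega
  rw [hD] at key
  exact key

end Achievability

/-! ### Assembling the capacity. -/

theorem ceil_half (K : ℕ) : ⌈(K : ℝ) / 2⌉₊ = (K + 1) / 2 := by
  refine le_antisymm (Nat.ceil_le.2 ?_) ?_
  · have h : K ≤ 2 * ((K + 1) / 2) := by omega
    have h' : (K : ℝ) ≤ 2 * (((K + 1) / 2 : ℕ) : ℝ) := by exact_mod_cast h
    linarith
  · have h : (K : ℝ) ≤ 2 * (⌈(K : ℝ) / 2⌉₊ : ℝ) := by linarith [Nat.le_ceil ((K : ℝ) / 2)]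
    have h' : K ≤ 2 * ⌈(K : ℝ) / 2⌉₊ := by exact_mod_cast h
    omega

section Capacity

variable {F : Type u} [Field F] [Fintype F] [MeasurableSpace F] [MeasurableSingletonClass F]
  {K N M : ℕ}

theorem pidCapacity_le {C : ℝ≥0∞} (h : ∀ s : PIDScheme F K N M, s.rate ≤ C) :
    pidCapacity F K N M ≤ C := by
  refine sSup_le ?_
  rintro R ⟨s, hR⟩
  exact hR.trans (h s)

theorem PIDAchievable.le_pidCapacity {R : ℝ≥0∞} (h : PIDAchievable F K N M R) :
    R ≤ pidCapacity F K N M :=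
  le_sSup h

end Capacity

theorem corollary2 (F : Type*) [Field F] [Fintype F] [MeasurableSpace F]
    [MeasurableSingletonClass F] (K N : ℕ) (hK : 2 ≤ K) :
    (⌈(K : ℝ) / 2⌉₊ + 1 ≤ N → pidCapacity F K N 2 = 2 / (K : ℝ≥0∞)) ∧
    (N = ⌈(K : ℝ) / 2⌉₊ → pidCapacity F K N 2 = 1 / (⌈(K : ℝ) / 2⌉₊ : ℝ≥0∞)) ∧
    (N < ⌈(K : ℝ) / 2⌉₊ → pidCapacity F K N 2 = 0) := by
  rw [ceil_half]
  refine ⟨fun hN => ?_, fun hN => ?_, fun hN => ?_⟩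
  · refine le_antisymm
      (pidCapacity_le fun s => s.rate_le_div (b := 2) (by omega) s.messages_mul_length_le) ?_
    refine PIDAchievable.le_pidCapacity ?_
    rcases Nat.even_or_odd' K with ⟨m, rfl | rfl⟩
    · have h := pidAchievable_additive_sharing F hK le_rfl (show m ≤ N by omega)
      have hm : (2 : ℝ≥0∞) / ((2 * m : ℕ) : ℝ≥0∞) = 1 / (m : ℝ≥0∞) := by
        rw [Nat.cast_mul, Nat.cast_ofNat]
        simpa using ENNReal.mul_div_mul_left 1 (m : ℝ≥0∞) two_ne_zero ENNReal.ofNat_ne_top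
      rwa [hm]
    · obtain ⟨j, rfl⟩ : ∃ j, m = j + 1 := ⟨m - 1, by omega⟩
      obtain ⟨r, rfl⟩ : ∃ r, N = 3 + j + r := ⟨N - (3 + j), by omega⟩
      exact pidAchievable_triangle F j r
  · rw [← hN]
    refine le_antisymm (pidCapacity_le fun s => ?_)
      (pidAchievable_additive_sharing F hK (by omega) le_rfl).le_pidCapacity
    have h : N * s.L ≤ 1 * ∑ n, s.D n := by
      rcases Nat.even_or_odd' K with ⟨m, hm | hm⟩
      · have hKN : K = 2 * N := by omega
        have h := s.messages_mul_length_le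
        have h' : K * s.L = 2 * (N * s.L) := by
          rw [← mul_assoc]
          exact congrArg (· * s.L) hKN
        omega
      · rw [one_mul]
        exact s.servers_mul_length_le (by omega)
    simpa using s.rate_le_div (by omega) h
  · refine le_antisymm (pidCapacity_le fun s => ?_) bot_le
    -- Every message must be stored somewhere, so K ≤ 2N and no scheme exists.
    have := s.messages_le_storage
    omega
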